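/- A quantum switch has $K$ links and $M$ types of requests; a type-$i$ request needs one Bell pair on each link of a set $\mathcal L_i\subseteq\{1,\dots,K\}$. In time-slot $n$ let $T(n)\in\{0,1\}^K$ be the link states ($T_j(n)=1$ if a Bell pair is created on link $j$, with probability $p_j$), $Z(n)\in\{0,1\}^M$ the swapping outcomes ($Z_i(n)=1$ with probability $q_i$) and $A(n)\in\mathbb Z_{\ge 0}^M$ the numbers of arriving requests, $E[A_i(n)]=\lambda_i<\infty$. The triples $(A(n),T(n),Z(n))$ are i.i.d. over $n$, and within a slot $A(n)$, $T(n)$, $Z(n)$ are independent of each other (the coordinates of each vector may be dependent). Let $\mathcal M$ be the set of matchings, i.e. of $\pi\in\{0,1\}^M$ with $\sum_{i:\,j\in\mathcal L_i}\pi_i\le 1$ for every link $j$; put $r_i(a,\pi)=q_i\,\mathbf 1\{\pi_i=1\}\,\mathbf 1\{a_j>0\ \forall j\in\mathcal L_i\}$. The capacity region $\Lambda$ is the set of $\lambda\in\mathbb R^M$ for which there are $b_{a,\pi}>0$ ($a\in\{0,1\}^K$, $\pi\in\mathcal M$) with $\sum_{\pi}b_{a,\pi}<1$ for every $a$ and $$\lambda_i\le\sum_{a\ne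 0}P(T(n)=a)\sum_{\pi\in\mathcal M}b_{a,\pi}\,r_i(a,\pi)\qquad(1\le i\le M).$$ A Max-Weight policy selects $W(n)\in\mathcal M$ as a function of $(Q(n),T(n))$ that maximizes $\sum_i r_i(T(n),\pi)Q_i(n)$ over $\pi\in\mathcal M$ (ties broken arbitrarily), and the queue lengths evolve as $Q(n+1)=Q(n)-D(n)+A(n)$ with $D_i(n)=Z_i(n)\mathbf 1\{W_i(n)>0\}\mathbf 1\{Q_i(n)>0\}\mathbf 1\{T_j(n)>0\ \forall j\in\mathcal L_i\}$. Theorem. Suppose that every type can be served, i.e. $q_i>0$ and $P(T_j(n)=1\ \forall j\in\mathcal L_i)>0$ for every $i$, and that $P(A(n)=0)>0$ (when $\lambda\in\Lambda$, this holds automatically if the arrivals of different types are independent). If $\lambda\in\Lambda$ and $E[A_i(n)^2]<\infty$ for every $i$, then every Max-Weight policy stabilizes the switch: there is a random vector $Q(\infty)$ with $E[Q_i(\infty)]<\infty$ for every $i$ such that, for every initial state $Q(0)\in\mathbb Z_{\ge 0}^M$, $Q(n)$ converges in distribution to $Q(\infty)$ as $n\to\infty$. -/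

import Mathlib

open MeasureTheory ProbabilityTheory Filter
open scoped BigOperators

noncomputable section

/-- The parameters of a quantum switch with `K` links and `M` types of requests. A request of type
`i` needs one Bell pair on each of the links in `links i`; `p j` is the probability that a Bell pair
is created on link `j` in a time-slot, and `q i` is the probability that an entanglement swapping
operation for a request of type `i` succeeds. -/
structure QuantumSwitch (K M : ℕ) where
  links : Fin M → Finset (Fin K)
  p : Fin K → ℝ
  q : Fin M → ℝ

namespace QuantumSwitch

variable {K M : ℕ} (S : QuantumSwitch K M)

/-- The types of requests that need a Bell pair of link `j`. -/
def typesUsing (j : Fin K) : Finset (Fin M) :=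
  Finset.univ.filter fun i => j ∈ S.links i

/-- The set of all `π ∈ {0,1}^M` that assign each link to at most one type of requests. (A vector
that maximizes a weight over the inclusion-maximal ones among these also maximizes it over all of
them, because the weights below are monotone in `π`.) -/
def matchings : Finset (Fin M → Fin 2) :=
  Finset.univ.filter fun π => ∀ j : Fin K, ∑ i ∈ S.typesUsing j, (π i : ℕ) ≤ 1

/-- The probability that a request of type `i` is served, given the link states `a` and the
selected matching `π`. -/
def successProb (a : Fin K → Fin 2) (π : Fin M → Fin 2) (i : Fin M) : ℝ :=
  S.q i * (if π i = 1 then 1 else 0) * (if ∀ j ∈ S.links i, 0 < a j then 1 else 0)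

/-- The capacity region, where `P a` is the probability that the vector of link states is `a`. -/
def capacityRegion (P : (Fin K → Fin 2) → ℝ) : Set (Fin M → ℝ) :=
  {lam | ∃ b : (Fin K → Fin 2) → (Fin M → Fin 2) → ℝ,
    (∀ a, ∀ π ∈ S.matchings, 0 < b a π) ∧
    (∀ a, ∑ π ∈ S.matchings, b a π < 1) ∧
    ∀ i, lam i ≤ ∑ a ∈ Finset.univ.filter (fun a : Fin K → Fin 2 => a ≠ 0),
      P a * ∑ π ∈ S.matchings, b a π * S.successProb a π i}

/-- `W x a` is the matching selected when the queue lengths are `x` and the link states are `a`.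
It is a Max-Weight policy if it always maximizes the weight over all matchings; ties are broken in
an arbitrary way. -/
def IsMaxWeight (W : (Fin M → ℕ) → (Fin K → Fin 2) → (Fin M → Fin 2)) : Prop :=
  ∀ (x : Fin M → ℕ) (a : Fin K → Fin 2),
    W x a ∈ S.matchings ∧
      ∀ π ∈ S.matchings,
        ∑ i, S.successProb a π i * (x i : ℝ) ≤ ∑ i, S.successProb a (W x a) i * (x i : ℝ)

/-- The number of requests of type `i` served in a time-slot with queue lengths `x`, link states
`a`, swapping outcomes `z` and selected matching `w`. -/
def departures (x : Fin M → ℕ) (a : Fin K → Fin 2) (z w : Fin M → Fin 2) (i : Fin M) : ℕ :=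
  (z i : ℕ) * (if 0 < w i then 1 else 0) * (if 0 < x i then 1 else 0) *
    (if ∀ j ∈ S.links i, 0 < a j then 1 else 0)

/-- The queue lengths at the beginning of time-slot `n`, started from `x₀`, under the policy `W`,
with arrivals `A`, link states `T` and swapping outcomes `Z`. The subtraction does not truncate,
since at most one request leaves a queue, and only when the queue is not empty. -/
def queue {Ω : Type*} (W : (Fin M → ℕ) → (Fin K → Fin 2) → (Fin M → Fin 2))
    (A : ℕ → Ω → Fin M → ℕ) (T : ℕ → Ω → Fin K → Fin 2) (Z : ℕ → Ω → Fin M → Fin 2)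
    (x₀ : Fin M → ℕ) : ℕ → Ω → Fin M → ℕ
  | 0, _ => x₀
  | n + 1, ω => fun i =>
      let x := queue W A T Z x₀ n ω
      x i - S.departures x (T n ω) (Z n ω) (W x (T n ω)) i + A n ω i

/-- The probabilistic assumptions on the arrivals `A`, the link states `T` and the swapping outcomes
`Z`: they are i.i.d. over time-slots, the three of them are independent of each other within a
time-slot, and they have the prescribed rates. Neither the arrivals of different types nor the
states of different links nor the outcomes for different types are required to be independent
within a time-slot. -/
structure IsInput {Ω : Type*} [MeasurableSpace Ω] (μ : Measure Ω)
    (A : ℕ → Ω → Fin M → ℕ) (T : ℕ → Ω → Fin K → Fin 2) (Z : ℕ → Ω → Fin M → Fin 2)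
    (lam : Fin M → ℝ) : Prop where
  measurable_arrivals : ∀ n, Measurable (A n)
  measurable_links : ∀ n, Measurable (T n)
  measurable_swaps : ∀ n, Measurable (Z n)
  indep_slots : iIndepFun (fun n ω => (A n ω, T n ω, Z n ω)) μ
  identDistrib : ∀ n, IdentDistrib (fun ω => (A n ω, T n ω, Z n ω))
    (fun ω => (A 0 ω, T 0 ω, Z 0 ω)) μ μ
  indep_arrivals : ∀ n, IndepFun (A n) (fun ω => (T n ω, Z n ω)) μ
  indep_links_swaps : ∀ n, IndepFun (T n) (Z n) μ
  integrable_arrivals : ∀ n i, Integrable (fun ω => (A n ω i : ℝ)) μ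
  mean_arrivals : ∀ n i, ∫ ω, (A n ω i : ℝ) ∂μ = lam i
  prob_links : ∀ n j, μ.real {ω | T n ω j = 1} = S.p j
  prob_swaps : ∀ n i, μ.real {ω | Z n ω i = 1} = S.q i

/-- The policy `W` stabilizes the switch: for every initial state, the queue lengths converge in
distribution to a random vector with finite mean, whose law does not depend on the initial
state. -/
def Stabilizes {Ω : Type*} [MeasurableSpace Ω] (μ : Measure Ω) [IsProbabilityMeasure μ]
    (A : ℕ → Ω → Fin M → ℕ) (T : ℕ → Ω → Fin K → Fin 2) (Z : ℕ → Ω → Fin M → Fin 2)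
    (W : (Fin M → ℕ) → (Fin K → Fin 2) → (Fin M → Fin 2)) : Prop :=
  ∃ ν : ProbabilityMeasure (Fin M → ℕ),
    (∀ i, Integrable (fun x : Fin M → ℕ => (x i : ℝ)) (ν : Measure (Fin M → ℕ))) ∧
    ∀ x₀ : Fin M → ℕ,
      TendstoInDistribution (fun n => S.queue W A T Z x₀ n) atTop
        (id : (Fin M → ℕ) → (Fin M → ℕ)) (fun _ => μ) (ν : Measure (Fin M → ℕ))

end QuantumSwitch

end

/-! The queue lengths form a Markov chain driven by i.i.d. inputs, and the proof rests on two
estimates for it. The first is the drift of V(x) = Σ xᵢ². In the capacity region the weights b(a, ·)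
sum to less than 1 for each link state a, so the maximal weight exceeds what is needed to match the
arrivals. Since every type is servable in some link state of positive probability, this excess is at
least ε Σ xᵢ (`exists_slack`). Hence E V(next) + 2ε Σ xᵢ ≤ V + C (`exists_drift`), where the second
moments of the arrivals keep C finite. Tightness of the Cesàro averages of the laws then yields a
stationary law with finite mean (`exists_invariant`).

The second is a synchronous coupling. From any two states, finitely many slots without arrivals can
empty both copies, so they can meet, and afterwards they stay together. The limiting probability u
of never meeting is a bounded harmonic function of the pair. The drift and a maximum principle
(`le_of_harmonic`) force u to attain its maximum, and the possibility of meeting forces that maximum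
to be 0 (`tendsto_disagree`). Coupling with a stationary copy gives convergence from every initial
state; no separate argument about irreducibility or periodicity is needed. -/

namespace RandomIteration

/-! ### Synchronous coupling and coalescence -/

open scoped Topology

variable {E S : Type*} [MeasurableSpace S]

/-- The transition operator of the Markov chain `X (n + 1) = F (X n) (ξ n)`, where the `ξ n` are
independent with law `κ`. -/
noncomputable def avg (κ : Measure S) (F : E → S → E) (f : E → ℝ) (x : E) : ℝ :=
  ∫ s, f (F x s) ∂κ

/-- Two copies of a random iteration, driven by the same input. -/
def pairMap (F : E → S → E) (w : E × E) (s : S) : E × E := (F w.1 s, F w.2 s)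

/-- The indicator function of the complement of the diagonal. -/
noncomputable def offDiag (w : E × E) : ℝ := by
  classical exact if w.1 = w.2 then 0 else 1

/-- The probability that two copies of the chain that are driven by the same input from the initial
states `w.1` and `w.2` differ at time `n`. -/
noncomputable def disagree (κ : Measure S) (F : E → S → E) (n : ℕ) : E × E → ℝ :=
  (avg κ (pairMap F))^[n] offDiag

variable (κ : Measure S) (F : E → S → E)

lemma iterate_avg_const_mul (c : ℝ) (f : E → ℝ) (n : ℕ) (x : E) :
    (avg κ F)^[n] (fun y => c * f y) x = c * (avg κ F)^[n] f x := by
  induction n generalizing x with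
  | zero => rfl
  | succ n ih =>
    simp only [Function.iterate_succ_apply', avg, ih, integral_const_mul]

lemma disagree_succ (n : ℕ) (w : E × E) :
    disagree κ F (n + 1) w = ∫ s, disagree κ F n (pairMap F w s) ∂κ := by
  unfold disagree
  rw [Function.iterate_succ_apply']; rfl

lemma offDiag_nonneg (w : E × E) : 0 ≤ offDiag w := by
  unfold offDiag; split_ifs <;> norm_num

lemma offDiag_le_one (w : E × E) : offDiag w ≤ 1 := by
  unfold offDiag; split_ifs <;> norm_num

lemma offDiag_self (x : E) : offDiag (x, x) = 0 := by simp [offDiag]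

lemma offDiag_of_ne {x y : E} (h : x ≠ y) : offDiag (x, y) = 1 := by simp [offDiag, h]

lemma abs_offDiag_le (w : E × E) : |offDiag w| ≤ 1 :=
  abs_le.2 ⟨by linarith [offDiag_nonneg w], offDiag_le_one w⟩

lemma disagree_nonneg (n : ℕ) (w : E × E) : 0 ≤ disagree κ F n w := by
  induction n generalizing w with
  | zero => exact offDiag_nonneg w
  | succ n ih => rw [disagree_succ]; exact integral_nonneg fun s => ih _

lemma disagree_self (n : ℕ) (x : E) : disagree κ F n (x, x) = 0 := by
  induction n generalizing x with
  | zero => exact offDiag_self x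
  | succ n ih => rw [disagree_succ]; simp [pairMap, ih]

variable [IsProbabilityMeasure κ]

lemma abs_avg_le {f : E → ℝ} {c : ℝ} (hf : ∀ x, |f x| ≤ c) (x : E) : |avg κ F f x| ≤ c := by
  have := norm_integral_le_of_norm_le_const (μ := κ) (f := fun s => f (F x s)) (C := c)
    (Eventually.of_forall fun s => hf _)
  simpa [avg] using this

lemma abs_iterate_avg_le {f : E → ℝ} {c : ℝ} (hf : ∀ x, |f x| ≤ c) (n : ℕ) (x : E) :
    |(avg κ F)^[n] f x| ≤ c := by
  induction n generalizing x with
  | zero => exact hf x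
  | succ n ih => rw [Function.iterate_succ_apply']; exact abs_avg_le κ F ih x

lemma abs_disagree_le (n : ℕ) (w : E × E) : |disagree κ F n w| ≤ 1 :=
  abs_iterate_avg_le κ _ abs_offDiag_le n w

lemma disagree_le_one (n : ℕ) (w : E × E) : disagree κ F n w ≤ 1 :=
  (abs_le.1 (abs_disagree_le κ F n w)).2

variable [DiscreteMeasurableSpace S]

lemma integrable_of_bounded {f : S → ℝ} {c : ℝ} (hf : ∀ s, |f s| ≤ c) : Integrable f κ :=
  Integrable.of_bound (Measurable.of_discrete).aestronglyMeasurable c (Eventually.of_forall hf)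

lemma avg_mono {f g : E → ℝ} {c d : ℝ} (hf : ∀ x, |f x| ≤ c) (hg : ∀ x, |g x| ≤ d)
    (h : ∀ x, f x ≤ g x) (x : E) : avg κ F f x ≤ avg κ F g x :=
  integral_mono (integrable_of_bounded κ fun _ => hf _) (integrable_of_bounded κ fun _ => hg _)
    fun _ => h _

lemma iterate_avg_mono {f g : E → ℝ} {c d : ℝ} (hf : ∀ x, |f x| ≤ c) (hg : ∀ x, |g x| ≤ d)
    (h : ∀ x, f x ≤ g x) (n : ℕ) (x : E) : (avg κ F)^[n] f x ≤ (avg κ F)^[n] g x := by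
  induction n generalizing x with
  | zero => exact h x
  | succ n ih =>
    simp only [Function.iterate_succ_apply']
    exact avg_mono κ F (abs_iterate_avg_le κ F hf n) (abs_iterate_avg_le κ F hg n) ih x

/-- Copies that have met receive the same input and never separate again. The base case is the only
place where the diagonal matters; the operator is monotone. -/
lemma antitone_disagree (w : E × E) : Antitone fun n => disagree κ F n w := by
  refine antitone_nat_of_succ_le fun n => ?_
  induction n generalizing w with
  | zero =>
    obtain ⟨x, y⟩ := w
    by_cases h : x = y
    · subst h; simp [disagree_self]
    · exact (disagree_le_one κ F 1 _).trans_eq (offDiag_of_ne h).symm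
  | succ n ih =>
    rw [disagree_succ, disagree_succ κ F n]
    exact integral_mono (integrable_of_bounded κ fun _ => abs_disagree_le κ F _ _)
      (integrable_of_bounded κ fun _ => abs_disagree_le κ F _ _) fun _ => ih _

/-- The distributions of two copies of the chain differ by at most the probability that the copies
have not coalesced. -/
lemma abs_iterate_avg_sub_le {f : E → ℝ} {b c : ℝ} (hb : ∀ x, |f x| ≤ b)
    (hc : ∀ x y, |f x - f y| ≤ c) (n : ℕ) (x y : E) :
    |(avg κ F)^[n] f x - (avg κ F)^[n] f y| ≤ c * disagree κ F n (x, y) := by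
  induction n generalizing x y with
  | zero =>
    by_cases h : x = y
    · subst h; simp [disagree_self]
    · have : disagree κ F 0 (x, y) = 1 := offDiag_of_ne h
      simpa [this] using hc x y
  | succ n ih =>
    have hint : ∀ x, Integrable (fun s => (avg κ F)^[n] f (F x s)) κ := fun x =>
      integrable_of_bounded κ fun _ => abs_iterate_avg_le κ F hb n _
    simp only [Function.iterate_succ_apply', disagree_succ]
    rw [avg, avg, ← integral_sub (hint x) (hint y), ← integral_const_mul]
    refine (abs_integral_le_integral_abs).trans (integral_mono ((hint x).sub (hint y)).abs
      ((integrable_of_bounded κ fun _ => abs_disagree_le κ F _ _).const_mul c) fun s => ih _ _)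

/-- The pair can coalesce if it can move to a pair that can coalesce. -/
lemma disagree_succ_lt_one {n : ℕ} {w : E × E} {s : S} (hs : κ {s} ≠ 0)
    (h : disagree κ F n (pairMap F w s) < 1) : disagree κ F (n + 1) w < 1 := by
  have hint : Integrable (fun s => disagree κ F n (pairMap F w s)) κ :=
    integrable_of_bounded κ fun _ => abs_disagree_le κ F _ _
  have hint' : Integrable (fun s => 1 - disagree κ F n (pairMap F w s)) κ :=
    (integrable_const _).sub hint
  have h1 : ∫ s, (1 - disagree κ F n (pairMap F w s)) ∂κ = 1 - disagree κ F (n + 1) w := by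
    rw [integral_sub (integrable_const _) hint, disagree_succ]; simp
  have h2 : 0 < ∫ s, (1 - disagree κ F n (pairMap F w s)) ∂κ := by
    rw [integral_pos_iff_support_of_nonneg
      (fun s => sub_nonneg.2 (disagree_le_one κ F n _)) hint']
    refine (pos_iff_ne_zero.2 hs).trans_le (measure_mono ?_)
    rintro _ rfl
    exact (sub_pos.2 h).ne'
  linarith

/-- The maximum principle: a bounded harmonic function is bounded by its maximum over a set outside
which a function with finite sublevel sets decreases on average. -/
lemma le_of_harmonic {u V : E → ℝ} {c s : ℝ} {B : Set E} (hu : ∀ x, |u x| ≤ c)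
    (hharm : ∀ x, avg κ F u x = u x) (hV0 : ∀ x, 0 ≤ V x)
    (hVint : ∀ x, Integrable (fun s => V (F x s)) κ)
    (hVfin : ∀ r, {x | V x ≤ r}.Finite) (hdrift : ∀ x ∉ B, avg κ F V x < V x)
    (hs : ∀ x ∈ B, u x ≤ s) (x : E) : u x ≤ s := by
  by_contra! hx
  -- A penalty `η * V` too small to bring the value at `x` down to `s`; the `+ 1` avoids dividing by
  -- zero.
  obtain ⟨η, hη, hηx⟩ : ∃ η > 0, s < u x - η * V x := by
    refine ⟨(u x - s) / (V x + 1), div_pos (sub_pos.2 hx) (by linarith [hV0 x]), ?_⟩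
    have h1 : 0 < V x + 1 := by linarith [hV0 x]
    have h2 : (u x - s) / (V x + 1) * V x < u x - s := by
      rw [div_mul_eq_mul_div, div_lt_iff₀ h1]
      nlinarith
    linarith
  set h : E → ℝ := fun y => u y - η * V y with hh
  -- As `u` is bounded, the penalized function can exceed its value at `x` only where `V` is
  -- bounded, so it has a global maximum.
  have hfin : {y | h x ≤ h y}.Finite := by
    refine (hVfin ((c - h x) / η)).subset fun y hy => ?_
    rw [Set.mem_ofPred_eq, le_div_iff₀ hη]
    have h1 := (abs_le.1 (hu y)).2
    have h2 : h x ≤ u y - η * V y := hy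
    nlinarith
  obtain ⟨y, hy, hmax⟩ := Set.exists_max_image _ h hfin ⟨x, le_refl (h x)⟩
  have hglob : ∀ z, h z ≤ h y := fun z => by
    by_cases hz : h x ≤ h z
    · exact hmax z hz
    · exact (not_le.1 hz).le.trans hy
  have hyB : y ∉ B := fun hyB => by
    have h1 := hs y hyB
    have h2 : h x ≤ u y - η * V y := hy
    have h3 := mul_nonneg hη.le (hV0 y)
    have h4 : s < h x := hηx
    linarith
  have huint : Integrable (fun s => u (F y s)) κ := integrable_of_bounded κ fun _ => hu _
  have h1 : ∫ s, h (F y s) ∂κ ≤ ∫ _, h y ∂κ :=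
    integral_mono (huint.sub ((hVint y).const_mul η)) (integrable_const _) fun s => hglob _
  have h2 : ∫ s, h (F y s) ∂κ = u y - η * avg κ F V y := by
    rw [← hharm y, avg, avg, ← integral_const_mul]
    exact integral_sub huint ((hVint y).const_mul η)
  rw [h2, integral_const, probReal_univ, one_smul] at h1
  -- At the maximum `y`, averaging keeps `u` and strictly lowers `V`, so the mean of `h` after one
  -- step would exceed `h y`.
  have h3 := hdrift y hyB
  have h4 : u y - η * avg κ F V y ≤ u y - η * V y := h1
  nlinarith

/-- Two copies of the chain that are driven by the same input coalesce almost surely, if they can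
coalesce and a Foster–Lyapunov condition holds. -/
theorem tendsto_disagree {V : E × E → ℝ} {B : Set (E × E)} (hB : B.Finite) (hV0 : ∀ w, 0 ≤ V w)
    (hVint : ∀ w, Integrable (fun s => V (pairMap F w s)) κ)
    (hVfin : ∀ r, {w | V w ≤ r}.Finite) (hdrift : ∀ w ∉ B, avg κ (pairMap F) V w < V w)
    (hreach : ∀ w, ∃ n, disagree κ F n w < 1) (w : E × E) :
    Tendsto (fun n => disagree κ F n w) atTop (𝓝 0) := by
  have hbdd : ∀ w, BddBelow (Set.range fun n => disagree κ F n w) := fun w =>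
    ⟨0, by rintro _ ⟨n, rfl⟩; exact disagree_nonneg κ F n w⟩
  set u : E × E → ℝ := fun w => ⨅ n, disagree κ F n w with hu
  have hlim : ∀ w, Tendsto (fun n => disagree κ F n w) atTop (𝓝 (u w)) := fun w =>
    tendsto_atTop_ciInf (antitone_disagree κ F w) (hbdd w)
  have hule : ∀ n w, u w ≤ disagree κ F n w := fun n w => ciInf_le (hbdd w) n
  have hu0 : ∀ w, 0 ≤ u w := fun w => le_ciInf fun n => disagree_nonneg κ F n w
  have hu1 : ∀ w, |u w| ≤ 1 := fun w =>
    abs_le.2 ⟨by linarith [hu0 w], (hule 0 w).trans (disagree_le_one κ F 0 w)⟩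
  have hharm : ∀ w, avg κ (pairMap F) u w = u w := fun w => by
    refine tendsto_nhds_unique ?_ ((tendsto_add_atTop_iff_nat 1).2 (hlim w))
    simp only [disagree_succ]
    exact tendsto_integral_of_dominated_convergence (fun _ => 1)
      (fun n => (Measurable.of_discrete).aestronglyMeasurable) (integrable_const _)
      (fun n => Eventually.of_forall fun s => abs_disagree_le κ F _ _)
      (Eventually.of_forall fun s => hlim _)
  -- Inserting `w` keeps the finite set nonempty; the maximum principle makes `v` a global maximum.
  obtain ⟨v, -, hv⟩ := Set.exists_max_image _ u (hB.insert w) ⟨w, Set.mem_insert _ _⟩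
  have hmax : ∀ z, u z ≤ u v := le_of_harmonic κ (pairMap F) hu1 hharm hV0 hVint hVfin hdrift
    fun z hz => hv z (Set.mem_insert_of_mem _ hz)
  obtain ⟨n, hn⟩ := hreach v
  have hfix : (avg κ (pairMap F))^[n] u = u := Function.iterate_fixed (funext hharm) n
  -- Since `u` vanishes on the diagonal, `u ≤ u v * offDiag`. Applying the operator `n` times fixes
  -- the left side and turns `offDiag` into `disagree`, which is below 1 at `v`.
  have h1 : u v ≤ u v * disagree κ F n v := by
    calc u v = (avg κ (pairMap F))^[n] u v := by rw [hfix]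
      _ ≤ (avg κ (pairMap F))^[n] (fun z => u v * offDiag z) v := by
        refine iterate_avg_mono κ _ (d := 1) hu1 (fun z => ?_) (fun z => ?_) n v
        · rw [abs_mul]
          exact mul_le_one₀ (hu1 v) (abs_nonneg _) (abs_offDiag_le z)
        · obtain ⟨x, y⟩ := z
          by_cases h : x = y
          · subst h
            rw [offDiag_self, mul_zero]
            exact (hule 0 _).trans (disagree_self κ F 0 x).le
          · rw [offDiag_of_ne h, mul_one]; exact hmax _
      _ = u v * disagree κ F n v := iterate_avg_const_mul κ _ _ _ n v
  have h2 : u v = 0 := by nlinarith [hu0 v]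
  have h3 : u w = 0 := le_antisymm (h2 ▸ hmax w) (hu0 w)
  exact h3 ▸ hlim w

end RandomIteration

/-! ### Stationary distributions and convergence to them -/

namespace RandomIteration

open scoped Topology ENNReal BoundedContinuousFunction NNReal

variable {E S : Type*} [MeasurableSpace E] [MeasurableSpace S]

/-- The average of the first `n + 1` members of a sequence of measures. -/
noncomputable def cesaro (ρ : ℕ → Measure E) (n : ℕ) : Measure E :=
  ((n + 1 : ℕ) : ℝ≥0∞)⁻¹ • ∑ i ∈ Finset.range (n + 1), ρ i

lemma lintegral_cesaro (ρ : ℕ → Measure E) (n : ℕ) (f : E → ℝ≥0∞) :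
    ∫⁻ x, f x ∂cesaro ρ n
      = ((n + 1 : ℕ) : ℝ≥0∞)⁻¹ * ∑ i ∈ Finset.range (n + 1), ∫⁻ x, f x ∂ρ i := by
  rw [cesaro, lintegral_smul_measure, lintegral_finsetSum_measure, smul_eq_mul]

variable [DiscreteMeasurableSpace E] [DiscreteMeasurableSpace S] (κ : Measure S) (F : E → S → E)

/-- If two copies of the chain that are driven by the same input coalesce almost surely, then the
distributions of the chain converge to a stationary distribution. -/
theorem tendsto_iterate_avg [IsProbabilityMeasure κ] {ν : Measure E} [IsProbabilityMeasure ν]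
    (hν : ∀ (f : E → ℝ) (c : ℝ), (∀ x, |f x| ≤ c) → ∫ x, avg κ F f x ∂ν = ∫ x, f x ∂ν)
    (hco : ∀ w, Tendsto (fun n => disagree κ F n w) atTop (𝓝 0)) {f : E → ℝ} {c : ℝ}
    (hf : ∀ x, |f x| ≤ c) (x : E) :
    Tendsto (fun n => (avg κ F)^[n] f x) atTop (𝓝 (∫ y, f y ∂ν)) := by
  have hinv : ∀ n, ∫ y, (avg κ F)^[n] f y ∂ν = ∫ y, f y ∂ν := fun n => by
    induction n with
    | zero => rfl
    | succ n ih =>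
      rw [← ih, ← hν _ c (abs_iterate_avg_le κ F hf n), Function.iterate_succ_apply']
  -- The second copy starts from the stationary law, so its law never changes.
  have h1 : Tendsto (fun n => ∫ y, disagree κ F n (x, y) ∂ν) atTop (𝓝 (∫ _, (0 : ℝ) ∂ν)) :=
    tendsto_integral_of_dominated_convergence (fun _ => 1)
      (fun n => Measurable.of_discrete.aestronglyMeasurable) (integrable_const _)
      (fun n => Eventually.of_forall fun y => abs_disagree_le κ F _ _)
      (Eventually.of_forall fun y => hco _)
  rw [integral_zero] at h1
  refine tendsto_iff_norm_sub_tendsto_zero.2 (squeeze_zero (fun _ => norm_nonneg _) (fun n => ?_)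
    (by simpa using h1.const_mul (c + c)))
  have hint : Integrable (fun y => (avg κ F)^[n] f y) ν :=
    integrable_of_bounded ν (abs_iterate_avg_le κ F hf n)
  rw [← hinv n, ← integral_const_mul]
  have h2 : (avg κ F)^[n] f x - ∫ y, (avg κ F)^[n] f y ∂ν
      = ∫ y, ((avg κ F)^[n] f x - (avg κ F)^[n] f y) ∂ν := by
    rw [integral_sub (integrable_const _) hint]; simp
  rw [h2]
  refine (norm_integral_le_integral_norm _).trans (integral_mono
    ((integrable_const _).sub hint).norm
    ((integrable_of_bounded ν fun _ => abs_disagree_le κ F _ _).const_mul _) fun y => ?_)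
  exact abs_iterate_avg_sub_le κ F hf
    (fun x y => (abs_sub _ _).trans (add_le_add (hf x) (hf y))) n x y

lemma integral_cesaro (ρ : ℕ → Measure E) [∀ n, IsProbabilityMeasure (ρ n)] (n : ℕ) {f : E → ℝ}
    {c : ℝ} (hf : ∀ x, |f x| ≤ c) :
    ∫ x, f x ∂cesaro ρ n = ((n + 1 : ℕ) : ℝ)⁻¹ * ∑ i ∈ Finset.range (n + 1), ∫ x, f x ∂ρ i := by
  rw [cesaro, integral_smul_measure,
    integral_finsetSum_measure fun i _ => integrable_of_bounded (ρ i) hf,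
    ENNReal.toReal_inv, ENNReal.toReal_natCast, smul_eq_mul]

variable [Countable E] [Countable S]

lemma lintegral_map_prod [SFinite κ] (ρ : Measure E) (f : E → ℝ≥0∞) :
    ∫⁻ x, f x ∂((ρ.prod κ).map fun p => F p.1 p.2) = ∫⁻ x, ∫⁻ s, f (F x s) ∂κ ∂ρ := by
  rw [lintegral_map Measurable.of_discrete Measurable.of_discrete]
  exact lintegral_prod (fun p : E × S => f (F p.1 p.2)) Measurable.of_discrete.aemeasurable

/-- A Foster–Lyapunov condition bounds the sums of the means of `g` along the chain. -/
lemma sum_lintegral_le [SFinite κ] {ρ : ℕ → Measure E} [∀ n, IsProbabilityMeasure (ρ n)]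
    (hρ : ∀ n, ρ (n + 1) = ((ρ n).prod κ).map fun p => F p.1 p.2) {V g : E → ℝ} {C : ℝ}
    (hV0 : ∀ x, 0 ≤ V x) (hg0 : ∀ x, 0 ≤ g x) (hC : 0 ≤ C)
    (hVint : ∀ x, Integrable (fun s => V (F x s)) κ)
    (hdrift : ∀ x, avg κ F V x + g x ≤ V x + C) (n : ℕ) :
    ∑ i ∈ Finset.range n, ∫⁻ x, ENNReal.ofReal (g x) ∂ρ i + ∫⁻ x, ENNReal.ofReal (V x) ∂ρ n
      ≤ ∫⁻ x, ENNReal.ofReal (V x) ∂ρ 0 + n * ENNReal.ofReal C := by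
  induction n with
  | zero => simp
  | succ n ih =>
    -- The drift is integrated in `ℝ≥0∞` without subtraction, so finiteness of the means of `V` need
    -- not be known for the telescoping.
    have h1 : ∫⁻ x, ENNReal.ofReal (g x) ∂ρ n + ∫⁻ x, ENNReal.ofReal (V x) ∂ρ (n + 1)
        ≤ ∫⁻ x, ENNReal.ofReal (V x) ∂ρ n + ENNReal.ofReal C := by
      rw [hρ, lintegral_map_prod, ← lintegral_add_left Measurable.of_discrete]
      calc _ ≤ ∫⁻ x, (ENNReal.ofReal (V x) + ENNReal.ofReal C) ∂ρ n := by
            refine lintegral_mono fun x => ?_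
            rw [← ofReal_integral_eq_lintegral_ofReal (hVint x)
              (Eventually.of_forall fun s => hV0 _), ← ENNReal.ofReal_add (hg0 x)
              (integral_nonneg fun s => hV0 _), ← ENNReal.ofReal_add (hV0 x) hC]
            have h := hdrift x
            rw [avg] at h
            exact ENNReal.ofReal_le_ofReal (by linarith)
        _ = _ := by rw [lintegral_add_right _ measurable_const]; simp
    rw [Finset.sum_range_succ, add_assoc]
    refine (add_le_add le_rfl h1).trans ?_
    rw [← add_assoc]
    refine (add_le_add ih le_rfl).trans_eq ?_
    push_cast
    ring

/-- A Foster–Lyapunov condition bounds the means of `g` under the Cesàro averages. -/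
lemma lintegral_cesaro_le [SFinite κ] {ρ : ℕ → Measure E} [∀ n, IsProbabilityMeasure (ρ n)]
    (hρ : ∀ n, ρ (n + 1) = ((ρ n).prod κ).map fun p => F p.1 p.2) {V g : E → ℝ} {C : ℝ}
    (hV0 : ∀ x, 0 ≤ V x) (hg0 : ∀ x, 0 ≤ g x) (hC : 0 ≤ C)
    (hVint : ∀ x, Integrable (fun s => V (F x s)) κ)
    (hdrift : ∀ x, avg κ F V x + g x ≤ V x + C) (n : ℕ) :
    ∫⁻ x, ENNReal.ofReal (g x) ∂cesaro ρ n
      ≤ ∫⁻ x, ENNReal.ofReal (V x) ∂ρ 0 + ENNReal.ofReal C := by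
  rw [lintegral_cesaro, ENNReal.inv_mul_le_iff (by simp) (ENNReal.natCast_ne_top _)]
  refine le_self_add.trans ((sum_lintegral_le κ F hρ hV0 hg0 hC hVint hdrift (n + 1)).trans ?_)
  rw [mul_add]
  refine add_le_add (le_mul_of_one_le_left' ?_) le_rfl
  exact_mod_cast Nat.le_add_left 1 n

variable [IsProbabilityMeasure κ]

lemma integral_map_prod (ρ : Measure E) [IsProbabilityMeasure ρ] {f : E → ℝ} {c : ℝ}
    (hf : ∀ x, |f x| ≤ c) :
    ∫ x, f x ∂((ρ.prod κ).map fun p => F p.1 p.2) = ∫ x, avg κ F f x ∂ρ := by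
  rw [integral_map Measurable.of_discrete.aemeasurable
    Measurable.of_discrete.aestronglyMeasurable]
  exact integral_prod (fun p : E × S => f (F p.1 p.2)) (integrable_of_bounded _ fun p => hf _)

instance isProbabilityMeasure_cesaro (ρ : ℕ → Measure E) [∀ n, IsProbabilityMeasure (ρ n)]
    (n : ℕ) : IsProbabilityMeasure (cesaro ρ n) := by
  constructor
  rw [cesaro, Measure.smul_apply, Measure.finsetSum_apply]
  simp only [measure_univ, Finset.sum_const, Finset.card_range, nsmul_eq_mul, mul_one,
    smul_eq_mul]
  exact ENNReal.inv_mul_cancel (by simp) (ENNReal.natCast_ne_top _)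

variable [TopologicalSpace E] [DiscreteTopology E] [BorelSpace E]

/-- A chain on a countable state space that satisfies a Foster–Lyapunov condition has a stationary
distribution under which `g` has a finite mean. -/
theorem exists_invariant {ρ : ℕ → Measure E} [∀ n, IsProbabilityMeasure (ρ n)]
    (hρ : ∀ n, ρ (n + 1) = ((ρ n).prod κ).map fun p => F p.1 p.2) {V g : E → ℝ} {C : ℝ}
    (hV0 : ∀ x, 0 ≤ V x) (hg0 : ∀ x, 0 ≤ g x) (hC : 0 ≤ C)
    (hVint : ∀ x, Integrable (fun s => V (F x s)) κ)
    (hdrift : ∀ x, avg κ F V x + g x ≤ V x + C) (hgfin : ∀ r, {x | g x ≤ r}.Finite)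
    (hρ0 : ∫⁻ x, ENNReal.ofReal (V x) ∂ρ 0 ≠ ∞) :
    ∃ ν : ProbabilityMeasure E, Integrable g (ν : Measure E) ∧
      ∀ (f : E → ℝ) (c : ℝ), (∀ x, |f x| ≤ c) →
        ∫ x, avg κ F f x ∂(ν : Measure E) = ∫ x, f x ∂(ν : Measure E) := by
  set D : ℝ≥0∞ := ∫⁻ x, ENNReal.ofReal (V x) ∂ρ 0 + ENNReal.ofReal C with hD
  have hDtop : D ≠ ∞ := ENNReal.add_ne_top.2 ⟨hρ0, ENNReal.ofReal_ne_top⟩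
  have hle := lintegral_cesaro_le κ F hρ hV0 hg0 hC hVint hdrift
  let c : ℕ → ProbabilityMeasure E := fun n => ⟨cesaro ρ n, inferInstance⟩
  -- Markov's inequality for `g`, whose sublevel sets are finite and hence compact.
  have htight : IsTightMeasureSet
      {((μ : ProbabilityMeasure E) : Measure E) | μ ∈ Set.range c} := by
    rw [isTightMeasureSet_iff_exists_isCompact_measure_compl_le]
    intro ε hε
    obtain ⟨k, hk⟩ := ENNReal.exists_nat_mul_gt hε.ne' hDtop
    refine ⟨{x | g x ≤ k}, (hgfin k).isCompact, ?_⟩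
    rintro _ ⟨_, ⟨n, rfl⟩, rfl⟩
    change cesaro ρ n _ ≤ ε
    by_contra! hlt
    have h1 : {x | g x ≤ k}ᶜ ⊆ {x | (k : ℝ≥0∞) ≤ ENNReal.ofReal (g x)} := fun x hx => by
      have : (k : ℝ) < g x := not_le.1 hx
      rw [Set.mem_ofPred_eq, ← ENNReal.ofReal_natCast]
      exact ENNReal.ofReal_le_ofReal this.le
    have h2 : (k : ℝ≥0∞) * cesaro ρ n {x | g x ≤ k}ᶜ ≤ D :=
      (mul_le_mul_right (measure_mono h1) _).trans
        ((mul_meas_ge_le_lintegral Measurable.of_discrete _).trans (hle n))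
    exact absurd ((mul_le_mul_right hlt.le _).trans h2) (not_le.2 hk)
  -- Prokhorov's theorem gives a cluster point; an ultrafilter then plays the role of a convergent
  -- subsequence.
  obtain ⟨ν, -, hν⟩ := (isCompact_closure_of_isTightMeasureSet htight) (f := map c atTop)
    (le_principal_iff.2 (mem_map.2 (Eventually.of_forall fun n =>
      subset_closure (Set.mem_range_self n))))
  obtain ⟨U, hU, hlim⟩ := mapClusterPt_iff_ultrafilter.1 hν
  refine ⟨ν, ?_, ?_⟩
  -- Weak convergence only tests bounded functions, so `g` is truncated at `k`; monotone convergence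
  -- removes the truncation.
  · have hbound : ∀ k : ℕ, ∫⁻ x, min (ENNReal.ofReal (g x)) k ∂(ν : Measure E) ≤ D := by
      intro k
      have hval : ∀ x, ((min (g x).toNNReal k : ℝ≥0) : ℝ≥0∞) = min (ENNReal.ofReal (g x)) k :=
        fun x => by rw [ENNReal.coe_min]; rfl
      have hlim' := ProbabilityMeasure.tendsto_iff_forall_lintegral_tendsto.1 hlim
        (BoundedContinuousFunction.mkOfDiscrete (fun x => min (g x).toNNReal (k : ℝ≥0)) k
          fun x y => by
            rw [NNReal.dist_eq]
            exact abs_sub_le_of_nonneg_of_le (NNReal.coe_nonneg _)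
              (by exact_mod_cast min_le_right _ _) (NNReal.coe_nonneg _)
              (by exact_mod_cast min_le_right _ _))
      simp only [BoundedContinuousFunction.mkOfDiscrete_apply, hval] at hlim'
      exact le_of_tendsto' hlim' fun n =>
        (lintegral_mono fun x => min_le_left _ _).trans (hle n)
    have hsup : ∀ x, ⨆ k : ℕ, min (ENNReal.ofReal (g x)) (k : ℝ≥0∞) = ENNReal.ofReal (g x) := by
      intro x
      refine le_antisymm (iSup_le fun k => min_le_left _ _) ?_
      obtain ⟨k, hk⟩ := ENNReal.exists_nat_gt (r := ENNReal.ofReal (g x)) ENNReal.ofReal_ne_top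
      exact le_iSup_of_le k (le_min le_rfl hk.le)
    refine ⟨Measurable.of_discrete.aestronglyMeasurable, ?_⟩
    rw [hasFiniteIntegral_iff_ofReal (Eventually.of_forall hg0)]
    refine lt_of_le_of_lt ?_ hDtop.lt_top
    rw [← lintegral_congr hsup]
    rw [lintegral_iSup (f := fun (k : ℕ) x => min (ENNReal.ofReal (g x)) (k : ℝ≥0∞)) (fun _ => Measurable.of_discrete)
      fun i j hij x => min_le_min le_rfl (by exact_mod_cast hij)]
    exact iSup_le hbound
  · intro f b hf
    have hb : 0 ≤ b := (abs_nonneg _).trans (hf (Classical.choice ν.nonempty))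
    have key : ∀ h : E → ℝ, (∀ x, |h x| ≤ b) →
        Tendsto (fun n => ∫ x, h x ∂cesaro ρ n) U (𝓝 (∫ x, h x ∂(ν : Measure E))) := fun h hh =>
      ProbabilityMeasure.tendsto_iff_forall_integral_tendsto.1 hlim
        (BoundedContinuousFunction.ofNormedAddCommGroup h continuous_of_discreteTopology b hh)
    have h1 := (key _ (abs_avg_le κ F hf)).sub (key f hf)
    -- Averaging `f` over one step shifts the Cesàro sum by one index, so only two boundary terms
    -- remain, divided by `n + 1`.
    have h2 : Tendsto (fun n => ∫ x, avg κ F f x ∂cesaro ρ n - ∫ x, f x ∂cesaro ρ n) atTop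
        (𝓝 0) := by
      have hval : ∀ n, ∫ x, avg κ F f x ∂cesaro ρ n - ∫ x, f x ∂cesaro ρ n
          = ((n + 1 : ℕ) : ℝ)⁻¹ * (∫ x, f x ∂ρ (n + 1) - ∫ x, f x ∂ρ 0) := fun n => by
        rw [integral_cesaro ρ n (abs_avg_le κ F hf), integral_cesaro ρ n hf, ← mul_sub,
          ← Finset.sum_sub_distrib, ← Finset.sum_range_sub (fun i => ∫ x, f x ∂ρ i)]
        simp_rw [hρ, integral_map_prod κ F _ hf]
      have hbd : ∀ n, |∫ x, f x ∂ρ n| ≤ b := fun n => by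
        simpa using norm_integral_le_of_norm_le_const (μ := ρ n) (f := f) (C := b)
          (Eventually.of_forall hf)
      simp_rw [hval]
      have h3 : Tendsto (fun n : ℕ => ((n + 1 : ℕ) : ℝ)⁻¹) atTop (𝓝 0) :=
        (tendsto_inv_atTop_nhds_zero_nat (𝕜 := ℝ)).comp (tendsto_add_atTop_nat 1)
      refine h3.zero_mul_isBoundedUnder_le ⟨b + b, ?_⟩
      exact eventually_map.2 (Eventually.of_forall fun n =>
        (abs_sub _ _).trans (add_le_add (hbd _) (hbd _)))
    exact sub_eq_zero.1 (tendsto_nhds_unique h1 (h2.mono_left hU))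

end RandomIteration

/-! ### Slack of the Max-Weight policy -/

namespace QuantumSwitch

open scoped Topology

variable {K M : ℕ} (S : QuantumSwitch K M)

section Weights

variable {S}

lemma successProb_nonneg (hq : ∀ i, 0 ≤ S.q i) (a : Fin K → Fin 2) (π : Fin M → Fin 2)
    (i : Fin M) : 0 ≤ S.successProb a π i := by
  unfold successProb
  have := hq i
  positivity

lemma single_mem_matchings (i : Fin M) : (Pi.single i 1 : Fin M → Fin 2) ∈ S.matchings := by
  simp only [matchings, Finset.mem_filter, Finset.mem_univ, true_and]
  intro j
  calc ∑ k ∈ S.typesUsing j, ((Pi.single i 1 : Fin M → Fin 2) k : ℕ)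
      ≤ ∑ k, ((Pi.single i 1 : Fin M → Fin 2) k : ℕ) :=
        Finset.sum_le_sum_of_subset (Finset.subset_univ _)
    _ = 1 := by
        rw [Finset.sum_eq_single i (fun k _ hk => by simp [hk]) (by simp)]
        simp

/-- The maximal weight is at least the weight of a matching that serves a single type. -/
lemma IsMaxWeight.le_weight {W : (Fin M → ℕ) → (Fin K → Fin 2) → (Fin M → Fin 2)}
    (hW : S.IsMaxWeight W) (x : Fin M → ℕ) {a : Fin K → Fin 2} {i : Fin M}
    (ha : ∀ j ∈ S.links i, a j = 1) :
    S.q i * x i ≤ ∑ k, S.successProb a (W x a) k * (x k : ℝ) := by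
  refine le_trans (le_of_eq ?_) ((hW x a).2 _ (single_mem_matchings i))
  rw [Finset.sum_eq_single i (fun k _ hk => by simp [successProb, hk]) (by simp)]
  have : ∀ j ∈ S.links i, 0 < a j := fun j hj => by rw [ha j hj]; exact Fin.zero_lt_one
  rw [successProb, if_pos this]
  simp

/-- For arrival rates in the capacity region, the mean weight that a Max-Weight policy serves
exceeds the mean weight that arrives by a multiple of the total queue length. -/
lemma exists_slack {W : (Fin M → ℕ) → (Fin K → Fin 2) → (Fin M → Fin 2)}
    (hW : S.IsMaxWeight W) {P : (Fin K → Fin 2) → ℝ} (hP : ∀ a, 0 ≤ P a) (hq : ∀ i, 0 < S.q i)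
    (hserve : ∀ i, ∃ a, (∀ j ∈ S.links i, a j = 1) ∧ 0 < P a) {lam : Fin M → ℝ}
    (hlam : lam ∈ S.capacityRegion P) :
    ∃ ε > 0, ∀ x : Fin M → ℕ, ∑ i, lam i * (x i : ℝ) + ε * ∑ i, (x i : ℝ)
      ≤ ∑ a, P a * ∑ i, S.successProb a (W x a) i * (x i : ℝ) := by
  obtain ⟨b, hb0, hb1, hb⟩ := hlam
  choose a ha hPa using hserve
  set β : (Fin K → Fin 2) → ℝ := fun a => ∑ π ∈ S.matchings, b a π with hβ
  -- A lower bound for the excess per waiting request of type `i`, taken from the single link state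
  -- `a i`, in which type `i` is servable.
  set δ : Fin M → ℝ := fun i => P (a i) * (1 - β (a i)) * S.q i with hδ
  have hδ0 : ∀ i, 0 < δ i := fun i =>
    mul_pos (mul_pos (hPa i) (sub_pos.2 (hb1 _))) (hq i)
  have hsum0 : 0 ≤ ∑ i, (δ i)⁻¹ := Finset.sum_nonneg fun i _ => (inv_pos.2 (hδ0 i)).le
  refine ⟨(∑ i, (δ i)⁻¹ + 1)⁻¹, by positivity, fun x => ?_⟩
  set m : (Fin K → Fin 2) → ℝ := fun a => ∑ i, S.successProb a (W x a) i * (x i : ℝ) with hm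
  have hm0 : ∀ a, 0 ≤ m a := fun a => Finset.sum_nonneg fun i _ =>
    mul_nonneg (successProb_nonneg (fun i => (hq i).le) _ _ _) (Nat.cast_nonneg _)
  have hβ0 : ∀ a, 0 ≤ β a := fun a => Finset.sum_nonneg fun π hπ => (hb0 a π hπ).le
  have h1 : ∑ i, lam i * (x i : ℝ) ≤ ∑ a, P a * (β a * m a) := by
    calc ∑ i, lam i * (x i : ℝ)
        ≤ ∑ i, (∑ a ∈ Finset.univ.filter (fun a : Fin K → Fin 2 => a ≠ 0),
            P a * ∑ π ∈ S.matchings, b a π * S.successProb a π i) * (x i : ℝ) :=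
          Finset.sum_le_sum fun i _ => mul_le_mul_of_nonneg_right (hb i) (Nat.cast_nonneg _)
      _ = ∑ a ∈ Finset.univ.filter (fun a : Fin K → Fin 2 => a ≠ 0),
            P a * ∑ π ∈ S.matchings, b a π * ∑ i, S.successProb a π i * (x i : ℝ) := by
          simp only [Finset.sum_mul, Finset.mul_sum]
          rw [Finset.sum_comm]
          refine Finset.sum_congr rfl fun a _ => ?_
          rw [Finset.sum_comm]
          exact Finset.sum_congr rfl fun π _ => Finset.sum_congr rfl fun i _ => by ring
      _ ≤ ∑ a ∈ Finset.univ.filter (fun a : Fin K → Fin 2 => a ≠ 0), P a * (β a * m a) := by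
          refine Finset.sum_le_sum fun a _ => mul_le_mul_of_nonneg_left ?_ (hP a)
          rw [hβ, Finset.sum_mul]
          exact Finset.sum_le_sum fun π hπ =>
            mul_le_mul_of_nonneg_left ((hW x a).2 π hπ) (hb0 a π hπ).le
      _ ≤ ∑ a, P a * (β a * m a) :=
          Finset.sum_le_sum_of_subset_of_nonneg (Finset.subset_univ _) fun a _ _ =>
            mul_nonneg (hP a) (mul_nonneg (hβ0 a) (hm0 a))
  -- The excess: the part of the maximal weight that the total masses `β a < 1` leave unused.
  set R : ℝ := ∑ a, P a * ((1 - β a) * m a) with hR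
  have hterm : ∀ a, 0 ≤ P a * ((1 - β a) * m a) := fun a =>
    mul_nonneg (hP a) (mul_nonneg (sub_nonneg.2 (hb1 a).le) (hm0 a))
  have hR0 : 0 ≤ R := Finset.sum_nonneg fun a _ => hterm a
  have h2 : R + ∑ a, P a * (β a * m a) = ∑ a, P a * m a := by
    rw [hR, ← Finset.sum_add_distrib]
    exact Finset.sum_congr rfl fun a _ => by ring
  have h3 : ∀ i, (x i : ℝ) ≤ (δ i)⁻¹ * R := fun i => by
    rw [le_inv_mul_iff₀ (hδ0 i)]
    calc δ i * x i = P (a i) * ((1 - β (a i)) * (S.q i * x i)) := by rw [hδ]; ring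
      _ ≤ P (a i) * ((1 - β (a i)) * m (a i)) :=
          mul_le_mul_of_nonneg_left (mul_le_mul_of_nonneg_left (hW.le_weight x (ha i))
            (sub_nonneg.2 (hb1 _).le)) (hP _)
      _ ≤ R := Finset.single_le_sum (fun a _ => hterm a) (Finset.mem_univ (a i))
  have h4 : ∑ i, (x i : ℝ) ≤ (∑ i, (δ i)⁻¹ + 1) * R := by
    have := Finset.sum_le_sum fun i (_ : i ∈ Finset.univ) => h3 i
    rw [← Finset.sum_mul] at this
    linarith
  have h5 : (∑ i, (δ i)⁻¹ + 1)⁻¹ * ∑ i, (x i : ℝ) ≤ R := by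
    rw [inv_mul_le_iff₀ (by positivity)]; exact h4
  linarith

end Weights

/-! ### The queue lengths as a random iteration -/

section Chain

/-- What happens in a time-slot: arrivals, link states and swapping outcomes. -/
abbrev Input (K M : ℕ) := (Fin M → ℕ) × (Fin K → Fin 2) × (Fin M → Fin 2)

/-- One step of the chain of queue lengths. -/
def step (W : (Fin M → ℕ) → (Fin K → Fin 2) → (Fin M → Fin 2)) (x : Fin M → ℕ)
    (s : Input K M) : Fin M → ℕ :=
  fun i => x i - S.departures x s.2.1 s.2.2 (W x s.2.1) i + s.1 i

variable (W : (Fin M → ℕ) → (Fin K → Fin 2) → (Fin M → Fin 2)) {Ω : Type*}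
  (A : ℕ → Ω → Fin M → ℕ) (T : ℕ → Ω → Fin K → Fin 2) (Z : ℕ → Ω → Fin M → Fin 2)

lemma queue_succ (x₀ : Fin M → ℕ) (n : ℕ) (ω : Ω) :
    S.queue W A T Z x₀ (n + 1) ω = S.step W (S.queue W A T Z x₀ n ω) (A n ω, T n ω, Z n ω) :=
  rfl

/-- Only slots before `n` enter; this gives both measurability and independence of slot `n`. -/
lemma exists_queue_eq_comp (x₀ : Fin M → ℕ) (n : ℕ) :
    ∃ φ : (Finset.range n → Input K M) → Fin M → ℕ,
      S.queue W A T Z x₀ n = φ ∘ fun ω i => (A i ω, T i ω, Z i ω) := by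
  induction n with
  | zero => exact ⟨fun _ => x₀, rfl⟩
  | succ n ih =>
    obtain ⟨φ, hφ⟩ := ih
    refine ⟨fun ξ => S.step W
      (φ fun i => ξ ⟨i, Finset.range_subset_range.2 n.le_succ i.2⟩)
      (ξ ⟨n, Finset.self_mem_range_succ n⟩), ?_⟩
    funext ω
    rw [queue_succ, hφ]
    rfl

lemma departures_le (x : Fin M → ℕ) (a : Fin K → Fin 2) (z w : Fin M → Fin 2) (i : Fin M) :
    S.departures x a z w i ≤ 1 ∧ S.departures x a z w i ≤ x i := by
  unfold departures
  have hz : (z i : ℕ) ≤ 1 := Nat.lt_succ_iff.1 (z i).isLt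
  split_ifs <;> grind

variable {S W A T Z} [MeasurableSpace Ω] {μ : Measure Ω} {lam : Fin M → ℝ}

namespace IsInput

lemma measurable_slot (h : S.IsInput μ A T Z lam) (n : ℕ) :
    Measurable fun ω => (A n ω, T n ω, Z n ω) :=
  (h.measurable_arrivals n).prodMk ((h.measurable_links n).prodMk (h.measurable_swaps n))

lemma measurable_queue (h : S.IsInput μ A T Z lam) (x₀ : Fin M → ℕ) (n : ℕ) :
    Measurable (S.queue W A T Z x₀ n) := by
  obtain ⟨φ, hφ⟩ := S.exists_queue_eq_comp W A T Z x₀ n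
  rw [hφ]
  exact Measurable.of_discrete.comp (measurable_pi_lambda _ fun i => h.measurable_slot i)

lemma indepFun_queue (h : S.IsInput μ A T Z lam) (x₀ : Fin M → ℕ) (n : ℕ) :
    IndepFun (S.queue W A T Z x₀ n) (fun ω => (A n ω, T n ω, Z n ω)) μ := by
  obtain ⟨φ, hφ⟩ := S.exists_queue_eq_comp W A T Z x₀ n
  have h1 := h.indep_slots.indepFun_finset (Finset.range n) {n} (by simp) h.measurable_slot
  rw [hφ]
  exact h1.comp (φ := φ) (ψ := fun ξ => ξ ⟨n, Finset.mem_singleton_self n⟩)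
    Measurable.of_discrete Measurable.of_discrete

variable [IsProbabilityMeasure μ]

/-- The law of the queue lengths in the next time-slot. -/
lemma map_queue_succ (h : S.IsInput μ A T Z lam) (x₀ : Fin M → ℕ) (n : ℕ) :
    μ.map (S.queue W A T Z x₀ (n + 1)) = ((μ.map (S.queue W A T Z x₀ n)).prod
      (μ.map fun ω => (A 0 ω, T 0 ω, Z 0 ω))).map fun p => S.step W p.1 p.2 := by
  rw [← (h.identDistrib n).map_eq, ← (indepFun_iff_map_prod_eq_prod_map_map
    (h.measurable_queue x₀ n).aemeasurable (h.measurable_slot n).aemeasurable).1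
    (h.indepFun_queue x₀ n), Measure.map_map Measurable.of_discrete
    ((h.measurable_queue x₀ n).prodMk (h.measurable_slot n))]
  rfl

/-- Links the actual process to the operator calculus. The last step of the chain is absorbed into
the test function, so the induction must generalize `f`. -/
lemma integral_queue (h : S.IsInput μ A T Z lam) (x₀ : Fin M → ℕ) (n : ℕ)
    {f : (Fin M → ℕ) → ℝ} {c : ℝ} (hf : ∀ x, |f x| ≤ c) :
    ∫ x, f x ∂(μ.map (S.queue W A T Z x₀ n))
      = (RandomIteration.avg (μ.map fun ω => (A 0 ω, T 0 ω, Z 0 ω)) (S.step W))^[n] f x₀ := by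
  have hκ := Measure.isProbabilityMeasure_map (μ := μ) (h.measurable_slot 0).aemeasurable
  induction n generalizing f with
  | zero =>
    rw [integral_map (h.measurable_queue x₀ 0).aemeasurable
      Measurable.of_discrete.aestronglyMeasurable]
    simp [queue]
  | succ n ih =>
    have hn := Measure.isProbabilityMeasure_map (μ := μ)
      (h.measurable_queue (W := W) x₀ n).aemeasurable
    rw [h.map_queue_succ, RandomIteration.integral_map_prod _ _ _ hf,
      ih (RandomIteration.abs_avg_le _ _ hf), Function.iterate_succ_apply]

end IsInput

end Chain

end QuantumSwitch

/-! ### Quadratic drift and reachability of coalescence -/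

namespace QuantumSwitch

open scoped Topology

variable {K M : ℕ} {S : QuantumSwitch K M}
  {W : (Fin M → ℕ) → (Fin K → Fin 2) → (Fin M → Fin 2)} {Ω : Type*}
  {A : ℕ → Ω → Fin M → ℕ} {T : ℕ → Ω → Fin K → Fin 2} {Z : ℕ → Ω → Fin M → Fin 2}
  {lam : Fin M → ℝ}

lemma finite_setOf_sum_le (r : ℝ) : {x : Fin M → ℕ | ∑ i, (x i : ℝ) ≤ r}.Finite := by
  refine (Set.finite_Iic (fun _ : Fin M => ⌈r⌉₊)).subset fun x hx i => ?_
  have h1 : (x i : ℝ) ≤ ∑ i, (x i : ℝ) :=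
    Finset.single_le_sum (f := fun i => (x i : ℝ)) (fun _ _ => Nat.cast_nonneg _)
      (Finset.mem_univ i)
  exact_mod_cast (h1.trans hx).trans (Nat.le_ceil r)

lemma sum_le_sum_sq (x : Fin M → ℕ) : ∑ i, (x i : ℝ) ≤ ∑ i, (x i : ℝ) ^ 2 :=
  Finset.sum_le_sum fun i _ => by exact_mod_cast Nat.le_self_pow two_ne_zero (x i)

/-- Expand (x − d + a)² with d ∈ {0, 1}: d² is at most 1 and −2da is dropped. -/
lemma step_sq_le (x : Fin M → ℕ) (s : Input K M) (i : Fin M) :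
    (S.step W x s i : ℝ) ^ 2 ≤ (x i : ℝ) ^ 2 + 1
      - 2 * ((x i : ℝ) * S.departures x s.2.1 s.2.2 (W x s.2.1) i)
      + 2 * (x i : ℝ) * s.1 i + (s.1 i : ℝ) ^ 2 := by
  obtain ⟨h1, h2⟩ := S.departures_le x s.2.1 s.2.2 (W x s.2.1) i
  rw [step, Nat.cast_add, Nat.cast_sub h2]
  have h3 : (S.departures x s.2.1 s.2.2 (W x s.2.1) i : ℝ) ≤ 1 := by exact_mod_cast h1
  have h4 : (0 : ℝ) ≤ S.departures x s.2.1 s.2.2 (W x s.2.1) i := Nat.cast_nonneg _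
  have h5 : (0 : ℝ) ≤ s.1 i := Nat.cast_nonneg _
  nlinarith [mul_nonneg h4 h5, mul_nonneg h4 (sub_nonneg.2 h3)]

/-- The weighted number of departures as a product of a swapping outcome and a function of the link
states. -/
lemma mul_departures (x : Fin M → ℕ) (a : Fin K → Fin 2) (z w : Fin M → Fin 2) (i : Fin M) :
    (x i : ℝ) * S.departures x a z w i
      = (((if w i = 1 then 1 else 0) * (if ∀ j ∈ S.links i, 0 < a j then 1 else 0)) * (x i : ℝ))
        * (z i : ℕ) := by
  have hw : 0 < w i ↔ w i = 1 := by omega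
  -- The factor `x i` makes the indicator of a nonempty queue redundant.
  by_cases hx : 0 < x i
  · simp only [departures, hw, if_pos hx]
    push_cast
    ring
  · simp [departures, Nat.eq_zero_of_not_pos hx]

variable [MeasurableSpace Ω] {μ : Measure Ω}

lemma exists_measure_fiber_ne_zero {α : Type*} [Countable α] {f : Ω → α} {p : α → Prop}
    (h : μ {ω | p (f ω)} ≠ 0) : ∃ a, p a ∧ μ {ω | f ω = a} ≠ 0 := by
  by_contra! hcon
  refine h (measure_mono_null (t := ⋃ a : {a // p a}, {ω | f ω = a}) (fun ω hω => ?_)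
    (measure_iUnion_null fun a => hcon a a.2))
  exact Set.mem_iUnion.2 ⟨⟨f ω, hω⟩, rfl⟩

namespace IsInput

lemma integral_swap (h : S.IsInput μ A T Z lam) (i : Fin M) :
    ∫ ω, ((Z 0 ω i : ℕ) : ℝ) ∂μ = S.q i := by
  have hmeas : MeasurableSet {ω | Z 0 ω i = 1} :=
    (measurable_pi_apply i).comp (h.measurable_swaps 0) (measurableSet_singleton (1 : Fin 2))
  rw [← h.prob_swaps 0 i, ← integral_indicator_one hmeas]
  refine integral_congr_ae (Eventually.of_forall fun ω => ?_)
  rcases Fin.exists_fin_two.1 ⟨Z 0 ω i, rfl⟩ with hz | hz <;>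
    simp [Set.indicator, hz]

variable [IsProbabilityMeasure μ]

lemma integral_links (h : S.IsInput μ A T Z lam) (φ : (Fin K → Fin 2) → ℝ) :
    ∫ ω, φ (T 0 ω) ∂μ = ∑ a, μ.real {ω | T 0 ω = a} * φ a := by
  have hT := h.measurable_links 0
  have := Measure.isProbabilityMeasure_map (μ := μ) hT.aemeasurable
  rw [← integral_map (φ := T 0) (f := φ) hT.aemeasurable
    Measurable.of_discrete.aestronglyMeasurable, integral_fintype (Integrable.of_finite)]
  refine Finset.sum_congr rfl fun a _ => ?_
  rw [map_measureReal_apply hT (measurableSet_singleton a)]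
  rfl

/-- The mean weighted number of departures in a time-slot. -/
lemma integral_departures (h : S.IsInput μ A T Z lam) (x : Fin M → ℕ) (i : Fin M) :
    ∫ ω, (x i : ℝ) * S.departures x (T 0 ω) (Z 0 ω) (W x (T 0 ω)) i ∂μ
      = ∑ a, μ.real {ω | T 0 ω = a} * (S.successProb a (W x a) i * (x i : ℝ)) := by
  set φ : (Fin K → Fin 2) → ℝ := fun a => ((if W x a i = 1 then 1 else 0) *
    (if ∀ j ∈ S.links i, 0 < a j then 1 else 0)) * (x i : ℝ) with hφ
  -- For fixed `x` the selected matching depends only on the link states, which are independent of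
  -- the swapping outcomes.
  have hind : IndepFun (fun ω => φ (T 0 ω)) (fun ω => ((Z 0 ω i : ℕ) : ℝ)) μ :=
    (h.indep_links_swaps 0).comp (φ := φ) (ψ := fun z : Fin M → Fin 2 => ((z i : ℕ) : ℝ))
      Measurable.of_discrete Measurable.of_discrete
  have hZ : Measurable fun ω => ((Z 0 ω i : ℕ) : ℝ) :=
    (Measurable.of_discrete (f := fun z : Fin M → Fin 2 => ((z i : ℕ) : ℝ))).comp
      (h.measurable_swaps 0)
  simp_rw [mul_departures]
  rw [hind.integral_fun_mul_eq_mul_integral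
    ((Measurable.of_discrete (f := φ)).comp (h.measurable_links 0)).aestronglyMeasurable
    hZ.aestronglyMeasurable, h.integral_swap, h.integral_links, Finset.sum_mul]
  refine Finset.sum_congr rfl fun a _ => ?_
  rw [hφ, successProb]
  ring

/-- The Foster–Lyapunov condition for the sum of the squares of the queue lengths. -/
lemma exists_drift (h : S.IsInput μ A T Z lam) (hq : ∀ i, 0 < S.q i)
    (hserve : ∀ i, 0 < μ {ω | ∀ j ∈ S.links i, T 0 ω j = 1})
    (hlam : lam ∈ S.capacityRegion fun a => μ.real {ω | T 0 ω = a})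
    (hsq : ∀ i, Integrable (fun ω => (A 0 ω i : ℝ) ^ 2) μ) (hW : S.IsMaxWeight W) :
    ∃ ε > 0, ∃ C : ℝ, 0 ≤ C ∧ ∀ x : Fin M → ℕ,
      Integrable (fun s => ∑ i, (S.step W x s i : ℝ) ^ 2)
        (μ.map fun ω => (A 0 ω, T 0 ω, Z 0 ω)) ∧
      RandomIteration.avg (μ.map fun ω => (A 0 ω, T 0 ω, Z 0 ω)) (S.step W)
          (fun x => ∑ i, (x i : ℝ) ^ 2) x + ε * ∑ i, (x i : ℝ) ≤ ∑ i, (x i : ℝ) ^ 2 + C := by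
  obtain ⟨ε, hε, hslack⟩ := exists_slack hW (fun a => measureReal_nonneg) hq (fun i => by
    obtain ⟨a, ha, h0⟩ := exists_measure_fiber_ne_zero (f := T 0)
      (p := fun a => ∀ j ∈ S.links i, a j = 1) (hserve i).ne'
    exact ⟨a, ha, ENNReal.toReal_pos h0 (measure_ne_top _ _)⟩) hlam
  set C : ℝ := ∑ i, (1 + ∫ ω, (A 0 ω i : ℝ) ^ 2 ∂μ) with hC
  -- The factor 2 comes from the cross term 2x(A − D) in the expanded square.
  refine ⟨2 * ε, by positivity, C, Finset.sum_nonneg fun i _ =>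
    add_nonneg zero_le_one (integral_nonneg fun ω => sq_nonneg _), fun x => ?_⟩
  have hslot := h.measurable_slot 0
  have hdep : ∀ i, Integrable (fun ω =>
      (x i : ℝ) * S.departures x (T 0 ω) (Z 0 ω) (W x (T 0 ω)) i) μ := fun i => by
    refine Integrable.of_bound (C := x i) ((Measurable.of_discrete (f := fun s : Input K M =>
      (x i : ℝ) * S.departures x s.2.1 s.2.2 (W x s.2.1) i)).comp hslot).aestronglyMeasurable
      (Eventually.of_forall fun ω => ?_)
    have h1 : (S.departures x (T 0 ω) (Z 0 ω) (W x (T 0 ω)) i : ℝ) ≤ 1 := by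
      exact_mod_cast (S.departures_le x _ _ _ i).1
    rw [Real.norm_of_nonneg (by positivity)]
    exact mul_le_of_le_one_right (Nat.cast_nonneg _) h1
  have hA := fun i => h.integrable_arrivals 0 i
  have hbase : ∀ i, Integrable (fun ω => (x i : ℝ) ^ 2 + 1
      - 2 * ((x i : ℝ) * S.departures x (T 0 ω) (Z 0 ω) (W x (T 0 ω)) i)) μ := fun i =>
    (integrable_const _).sub ((hdep i).const_mul 2)
  have hsum : ∀ i, Integrable (fun ω => (x i : ℝ) ^ 2 + 1
      - 2 * ((x i : ℝ) * S.departures x (T 0 ω) (Z 0 ω) (W x (T 0 ω)) i)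
      + 2 * (x i : ℝ) * A 0 ω i) μ := fun i => (hbase i).add ((hA i).const_mul _)
  have hbound : ∀ i, Integrable (fun ω => (x i : ℝ) ^ 2 + 1
      - 2 * ((x i : ℝ) * S.departures x (T 0 ω) (Z 0 ω) (W x (T 0 ω)) i)
      + 2 * (x i : ℝ) * A 0 ω i + (A 0 ω i : ℝ) ^ 2) μ := fun i =>
    (hsum i).add (hsq i)
  have hstep : ∀ i, Integrable
      (fun ω => (S.step W x (A 0 ω, T 0 ω, Z 0 ω) i : ℝ) ^ 2) μ := fun i =>
    (hbound i).mono' ((Measurable.of_discrete (f := fun s : Input K M =>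
      (S.step W x s i : ℝ) ^ 2)).comp hslot).aestronglyMeasurable
      (Eventually.of_forall fun ω => by
        rw [Real.norm_of_nonneg (sq_nonneg _)]
        exact step_sq_le x (A 0 ω, T 0 ω, Z 0 ω) i)
  constructor
  · rw [integrable_map_measure Measurable.of_discrete.aestronglyMeasurable hslot.aemeasurable]
    exact integrable_finsetSum _ fun i _ => hstep i
  · have h1 : ∀ i, ∫ ω, (S.step W x (A 0 ω, T 0 ω, Z 0 ω) i : ℝ) ^ 2 ∂μ
        ≤ (x i : ℝ) ^ 2 + (1 + ∫ ω, (A 0 ω i : ℝ) ^ 2 ∂μ) + 2 * (lam i * (x i : ℝ))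
          - 2 * ∑ a, μ.real {ω | T 0 ω = a} * (S.successProb a (W x a) i * (x i : ℝ)) :=
      fun i => by
        refine (integral_mono (hstep i) (hbound i)
          fun ω => step_sq_le x (A 0 ω, T 0 ω, Z 0 ω) i).trans_eq ?_
        rw [integral_add (hsum i) (hsq i),
          integral_add (hbase i) ((hA i).const_mul (2 * (x i : ℝ))),
          integral_sub (integrable_const _) ((hdep i).const_mul 2), integral_const_mul,
          h.integral_departures, integral_const_mul, h.mean_arrivals, integral_const,
          probReal_univ, one_smul]
        ring
    rw [RandomIteration.avg, integral_map hslot.aemeasurable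
      Measurable.of_discrete.aestronglyMeasurable, integral_finsetSum _ fun i _ => hstep i]
    have h2 := Finset.sum_le_sum fun i (_ : i ∈ Finset.univ) => h1 i
    rw [Finset.sum_sub_distrib, Finset.sum_add_distrib, Finset.sum_add_distrib,
      ← Finset.mul_sum, ← Finset.mul_sum, Finset.sum_comm] at h2
    simp_rw [← Finset.mul_sum] at h2
    have h3 := hslack x
    linarith

/-- Independence within the slot lets arrivals, link states and outcomes be prescribed separately.
-/
lemma slot_singleton_ne_zero (h : S.IsInput μ A T Z lam) {α : Fin M → ℕ} {a : Fin K → Fin 2}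
    {z : Fin M → Fin 2} (hα : μ {ω | A 0 ω = α} ≠ 0) (ha : μ {ω | T 0 ω = a} ≠ 0)
    (hz : μ {ω | Z 0 ω = z} ≠ 0) : (μ.map fun ω => (A 0 ω, T 0 ω, Z 0 ω)) {(α, a, z)} ≠ 0 := by
  have hA := h.measurable_arrivals 0
  have hT := h.measurable_links 0
  have hZ := h.measurable_swaps 0
  rw [(indepFun_iff_map_prod_eq_prod_map_map hA.aemeasurable (hT.prodMk hZ).aemeasurable).1
    (h.indep_arrivals 0), (indepFun_iff_map_prod_eq_prod_map_map hT.aemeasurable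
    hZ.aemeasurable).1 (h.indep_links_swaps 0), ← Set.singleton_prod_singleton, Measure.prod_prod,
    ← Set.singleton_prod_singleton, Measure.prod_prod, Measure.map_apply hA
    (measurableSet_singleton _), Measure.map_apply hT (measurableSet_singleton _),
    Measure.map_apply hZ (measurableSet_singleton _)]
  exact mul_ne_zero hα (mul_ne_zero ha hz)

/-- When a queue is not empty, the total queue length can decrease without arrivals. -/
lemma exists_sum_step_lt (h : S.IsInput μ A T Z lam) (hq : ∀ i, 0 < S.q i)
    (hserve : ∀ i, 0 < μ {ω | ∀ j ∈ S.links i, T 0 ω j = 1}) (hidle : 0 < μ {ω | A 0 ω = 0})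
    (hW : S.IsMaxWeight W) {x : Fin M → ℕ} (hx : x ≠ 0) :
    ∃ s : Input K M, (μ.map fun ω => (A 0 ω, T 0 ω, Z 0 ω)) {s} ≠ 0 ∧ s.1 = 0 ∧
      ∑ i, S.step W x s i < ∑ i, x i := by
  obtain ⟨i, hi⟩ := Function.ne_iff.1 hx
  obtain ⟨a, ha, ha0⟩ := exists_measure_fiber_ne_zero (f := T 0)
    (p := fun a => ∀ j ∈ S.links i, a j = 1) (hserve i).ne'
  have hpos : 0 < ∑ k, S.successProb a (W x a) k * (x k : ℝ) :=
    (mul_pos (hq i) (by exact_mod_cast Nat.pos_of_ne_zero hi)).trans_le (hW.le_weight x ha)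
  -- The selected weight is positive, so some nonempty queue `k` is really served, though perhaps
  -- not `i`.
  obtain ⟨k, -, hk⟩ := Finset.exists_ne_zero_of_sum_ne_zero hpos.ne'
  have hxk : x k ≠ 0 := fun h0 => hk (by simp [h0])
  have hwk : W x a k = 1 := by
    by_contra h0
    exact hk (by simp [successProb, h0])
  have hak : ∀ j ∈ S.links k, 0 < a j := by
    by_contra h0
    exact hk (by rw [successProb, if_neg h0]; simp)
  obtain ⟨z, hz, hz0⟩ := exists_measure_fiber_ne_zero (μ := μ) (f := Z 0) (p := fun z => z k = 1)
    (fun h0 => (hq k).ne' (by rw [← h.prob_swaps 0 k, measureReal_def, h0]; rfl))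
  refine ⟨(0, a, z), h.slot_singleton_ne_zero hidle.ne' ha0 hz0, rfl,
    Finset.sum_lt_sum (fun i _ => by simp [step]) ⟨k, Finset.mem_univ k, ?_⟩⟩
  have hd : S.departures x a z (W x a) k = 1 := by
    rw [departures, if_pos hak]
    simp [hz, hwk, Nat.pos_of_ne_zero hxk]
  simp only [step, hd, Pi.zero_apply]
  omega

/-- Two copies of the queue lengths that are driven by the same input can coalesce. -/
lemma exists_disagree_lt_one (h : S.IsInput μ A T Z lam) (hq : ∀ i, 0 < S.q i)
    (hserve : ∀ i, 0 < μ {ω | ∀ j ∈ S.links i, T 0 ω j = 1}) (hidle : 0 < μ {ω | A 0 ω = 0})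
    (hW : S.IsMaxWeight W) (w : (Fin M → ℕ) × (Fin M → ℕ)) :
    ∃ n, RandomIteration.disagree (μ.map fun ω => (A 0 ω, T 0 ω, Z 0 ω)) (S.step W) n w < 1 := by
  have hκ := Measure.isProbabilityMeasure_map (μ := μ) (h.measurable_slot 0).aemeasurable
  -- Without arrivals neither copy grows, so lowering one copy lowers the joint total; the copies
  -- meet at the empty state at the latest.
  induction hn : ∑ i, w.1 i + ∑ i, w.2 i using Nat.strong_induction_on generalizing w with
  | _ n ih =>
    have hle : ∀ (y : Fin M → ℕ) (s : Input K M), s.1 = 0 → ∑ i, S.step W y s i ≤ ∑ i, y i :=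
      fun y s hs => Finset.sum_le_sum fun i _ => by simp [step, hs]
    have hmove : ∀ s : Input K M, (μ.map fun ω => (A 0 ω, T 0 ω, Z 0 ω)) {s} ≠ 0 →
        ∑ i, S.step W w.1 s i + ∑ i, S.step W w.2 s i < n →
        ∃ n, RandomIteration.disagree (μ.map fun ω => (A 0 ω, T 0 ω, Z 0 ω)) (S.step W) n w < 1 :=
      fun s hs hlt => by
        obtain ⟨m, hm⟩ := ih _ hlt (RandomIteration.pairMap (S.step W) w s) rfl
        exact ⟨m + 1, RandomIteration.disagree_succ_lt_one _ _ hs hm⟩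
    by_cases h1 : w.1 = 0
    · by_cases h2 : w.2 = 0
      · refine ⟨0, ?_⟩
        rw [← Prod.mk.eta (p := w), h1, h2, RandomIteration.disagree_self]
        exact zero_lt_one
      · obtain ⟨s, hs, hs0, hlt⟩ := h.exists_sum_step_lt hq hserve hidle hW h2
        exact hmove s hs (hn ▸ add_lt_add_of_le_of_lt (hle _ s hs0) hlt)
    · obtain ⟨s, hs, hs0, hlt⟩ := h.exists_sum_step_lt hq hserve hidle hW h1
      exact hmove s hs (hn ▸ add_lt_add_of_lt_of_le hlt (hle _ s hs0))

end IsInput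

end QuantumSwitch

/-! ### Stability of Max-Weight -/

open RandomIteration QuantumSwitch in
/-- Max-Weight stabilizes the switch for all arrival rates in the capacity region. The hypotheses
`hserve` (each type of requests has a positive probability of being servable) and `hidle` (with
positive probability nothing arrives in a time-slot) make the empty state reachable. -/
theorem theorem2 {K M : ℕ} (S : QuantumSwitch K M)
    {Ω : Type*} [MeasurableSpace Ω] (μ : Measure Ω) [IsProbabilityMeasure μ]
    (A : ℕ → Ω → Fin M → ℕ) (T : ℕ → Ω → Fin K → Fin 2) (Z : ℕ → Ω → Fin M → Fin 2)
    (lam : Fin M → ℝ) (hinput : S.IsInput μ A T Z lam)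
    (hserve : ∀ i, 0 < S.q i ∧ 0 < μ {ω | ∀ j ∈ S.links i, T 0 ω j = 1})
    (hidle : 0 < μ {ω | A 0 ω = 0})
    (hlam : lam ∈ S.capacityRegion (fun a => μ.real {ω | T 0 ω = a}))
    (hsq : ∀ n i, Integrable (fun ω => (A n ω i : ℝ) ^ 2) μ)
    (W : (Fin M → ℕ) → (Fin K → Fin 2) → (Fin M → Fin 2)) (hW : S.IsMaxWeight W) :
    S.Stabilizes μ A T Z W := by
  have hq := fun i => (hserve i).1
  have hT := fun i => (hserve i).2
  set κ := μ.map fun ω => (A 0 ω, T 0 ω, Z 0 ω)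
  have hκ : IsProbabilityMeasure κ :=
    Measure.isProbabilityMeasure_map (hinput.measurable_slot 0).aemeasurable
  obtain ⟨ε, hε, C, hC, hdr⟩ := hinput.exists_drift hq hT hlam (hsq 0) hW
  set V : (Fin M → ℕ) → ℝ := fun x => ∑ i, (x i : ℝ) ^ 2
  set g : (Fin M → ℕ) → ℝ := fun x => ε * ∑ i, (x i : ℝ) with hgdef
  have hV0 : ∀ x, 0 ≤ V x := fun x => Finset.sum_nonneg fun i _ => sq_nonneg _
  have hg0 : ∀ x, 0 ≤ g x := fun x => by positivity
  have hVint : ∀ x, Integrable (fun s => V (S.step W x s)) κ := fun x => (hdr x).1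
  have hdrift : ∀ x, avg κ (S.step W) V x + g x ≤ V x + C := fun x => (hdr x).2
  have hVfin : ∀ r, {x | V x ≤ r}.Finite := fun r =>
    (finite_setOf_sum_le r).subset fun x hx => (sum_le_sum_sq x).trans hx
  have hgfin : ∀ r, {x | g x ≤ r}.Finite := fun r =>
    (finite_setOf_sum_le (r / ε)).subset fun x hx => (le_div_iff₀' hε).2 hx
  have hlaw : ∀ x₀ n, IsProbabilityMeasure (μ.map (S.queue W A T Z x₀ n)) := fun x₀ n =>
    Measure.isProbabilityMeasure_map (hinput.measurable_queue x₀ n).aemeasurable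
  have hco : ∀ w, Tendsto (fun n => disagree κ (S.step W) n w) atTop (nhds 0) := by
    have hint : ∀ w : (Fin M → ℕ) × (Fin M → ℕ), Integrable (fun s =>
        V (pairMap (S.step W) w s).1 + V (pairMap (S.step W) w s).2) κ := fun w =>
      (hVint w.1).add (hVint w.2)
    -- Each copy contributes at most `C` to the drift, so outside this square `g w.1 + g w.2 > 2 *
    -- C` makes it negative.
    refine tendsto_disagree κ (S.step W) (V := fun w => V w.1 + V w.2)
      (B := {x | g x ≤ 2 * C} ×ˢ {x | g x ≤ 2 * C}) ((hgfin _).prod (hgfin _))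
      (fun w => add_nonneg (hV0 _) (hV0 _)) hint (fun r => ?_) (fun w hw => ?_)
      (hinput.exists_disagree_lt_one hq hT hidle hW)
    · refine ((hVfin r).prod (hVfin r)).subset fun w hw => ?_
      have h : V w.1 + V w.2 ≤ r := hw
      have h1 : V w.1 ≤ r := by linarith [hV0 w.2]
      have h2 : V w.2 ≤ r := by linarith [hV0 w.1]
      exact ⟨h1, h2⟩
    · have h1 : avg κ (pairMap (S.step W)) (fun w => V w.1 + V w.2) w
          = avg κ (S.step W) V w.1 + avg κ (S.step W) V w.2 :=
        integral_add (hVint w.1) (hVint w.2)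
      have h2 : 2 * C < g w.1 + g w.2 := by
        by_contra! hle
        have h3 : g w.1 ≤ 2 * C := by linarith [hg0 w.2]
        have h4 : g w.2 ≤ 2 * C := by linarith [hg0 w.1]
        exact hw ⟨h3, h4⟩
      rw [h1]
      linarith [hdrift w.1, hdrift w.2]
  -- The Cesàro averages start from the empty switch, where `V` is 0.
  obtain ⟨ν, hνg, hν⟩ := exists_invariant κ (S.step W)
    (ρ := fun n => μ.map (S.queue W A T Z 0 n)) (hinput.map_queue_succ (W := W) 0) hV0 hg0
    hC hVint hdrift hgfin (by
      rw [lintegral_map Measurable.of_discrete (hinput.measurable_queue 0 0)]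
      simp [queue])
  refine ⟨ν, fun i => ?_, fun x₀ => ?_⟩
  · refine (hνg.const_mul ε⁻¹).mono' Measurable.of_discrete.aestronglyMeasurable
      (Eventually.of_forall fun x => ?_)
    rw [hgdef, inv_mul_cancel_left₀ hε.ne', Real.norm_of_nonneg (Nat.cast_nonneg _)]
    exact Finset.single_le_sum (f := fun i => (x i : ℝ)) (fun _ _ => Nat.cast_nonneg _)
      (Finset.mem_univ i)
  · refine ⟨fun n => (hinput.measurable_queue x₀ n).aemeasurable, aemeasurable_id, ?_⟩
    refine ProbabilityMeasure.tendsto_iff_forall_integral_tendsto.2 fun f => ?_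
    have h := tendsto_iterate_avg κ (S.step W) hν hco (fun x => f.norm_coe_le_norm x) x₀
    have hcongr : ∀ n, ∫ x, f x ∂(μ.map (S.queue W A T Z x₀ n))
        = (avg κ (S.step W))^[n] f x₀ := fun n =>
      hinput.integral_queue x₀ n fun x => f.norm_coe_le_norm x
    simp only [ProbabilityMeasure.coe_mk, hcongr, Measure.map_id]
    exact h
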